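/- **Setting.** Let $\mathcal A=\bigoplus_{k\in\mathbb Z^n}\mathcal A^{(k)}$ be a unital complex $*$-algebra graded by $\mathbb Z^n$ with $(\mathcal A^{(k)})^*\subseteq\mathcal A^{(-k)}$ (equivalently, a comodule $*$-algebra over the Hopf algebra of $\mathbb T^n$; in particular it may be the total algebra of a quantum principal $\mathbb T^n$-bundle). Let $\delta_j$ be the derivation of $\mathcal A$ with $\delta_j(a)=k_ja$ for $a\in\mathcal A^{(k)}$, and let $\mathcal B=\mathcal A^{(0)}$ be the invariant subalgebra. A *spectral triple* $(\mathcal A,\mathcal H,D)$ is a unital $*$-representation of $\mathcal A$ by bounded operators on a Hilbert space $\mathcal H$ together with a (densely defined) selfadjoint operator $D$ with compact resolvent such that every $a\in\mathcal A$ preserves $\mathrm{dom}\,D$ and $[D,a]$ is bounded. It is an *even real spectral triple* $(\mathcal A,\mathcal H,D,J,\gamma)$ of (even) $KR$-dimension $d$ modulo $8$ if $\gamma$ is bounded with $\gamma^2=1$, $\gamma^*=\gamma$, $[\gamma,a]=0$ for $a\in\mathcal A$, $\gamma D=-D\gamma$, and $J$ is antiunitary with $J^2=\epsilon$, $JD=DJ$,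 $J\gamma=\epsilon''\gamma J$, where $(\epsilon,\epsilon'')=(+,+),(-,-),(-,+),(+,-)$ for $d=0,2,4,6$, and $[a,Jb^*J^{-1}]=0$, $[[D,a],Jb^*J^{-1}]=0$ for all $a,b\in\mathcal A$. It is *$\mathbb T^n$-equivariant* if it comes with selfadjoint operators $\delta_1,\dots,\delta_n$ on $\mathcal H$ which commute strongly with one another and with $D$, satisfy $\delta_jJ=-J\delta_j$ and $[\delta_j,\gamma]=0$, and have a common core stable under $\mathcal A$ on which $\delta_j(a\psi)=\delta_j(a)\psi+a\,\delta_j\psi$. It is *projectable* if there is a bounded operator $\Gamma$ on $\mathcal H$ with $\Gamma^2=1$, $\Gamma^*=\Gamma$, $[\Gamma,a]=0$ for $a\in\mathcal A$, $[\Gamma,\delta_j]=0$, $J\Gamma=-\Gamma J$, $\Gamma\gamma=(-1)^n\gamma\Gamma$. The *horizontal Dirac operator* is, on $\{\psi\in\mathrm{dom}\,D:\Gamma\psi\in\mathrm{dom}\,D\}$, $$D_h=\tfrac12\Gamma(D\Gamma+\Gamma D)\ \ (n\text{ even}),\qquad D_h=s\,\tfrac12\Gamma(D\Gamma-\Gamma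 D)\ \ (n\text{ odd}),$$ where $s\in\{1,-1\}$ is a fixed sign convention (for $s=-1$, $D_h=\tfrac12(D-\Gamma D\Gamma)$ is the part of $D$ anticommuting with $\Gamma$). Let $\mathcal H_0=\bigcap_j\ker\delta_j$. The fibres are *isometric* if there are an operator $D_v$ and a bounded operator $Z$ on $\mathcal H$ with $D=D_v+D_h+Z$ (as unbounded operators, including domains) such that: $D_v$ vanishes on $\mathcal H_0\cap\mathrm{dom}\,D_v$; $D_v$ commutes with $\Gamma$ if $n$ is odd and anticommutes with $\Gamma$ if $n$ is even; $D_v$ commutes with (the resolvents of) every $\delta_j$; $Z$ commutes with $\mathcal A$; and there is a bounded selfadjoint $Z'$ with $Ja^*J^{-1}Z=Z'Ja^*J^{-1}$ for all $a\in\mathcal A$. **Proposition.** Let $(\mathcal A,\mathcal H,D,J,\gamma,\{\delta_j\},\Gamma)$ be an even projectable $\mathbb T^n$-equivariant real spectral triple with isometric fibres. Then $\mathcal H_0$ is a closed subspace, $\mathcal B$, $J$, $\gamma$, $\Gamma$ and $\gamma\Gamma$ restrict to $\mathcal H_0$, and $D_h$ maps $\mathcal H_0\cap\mathrm{dom}\,D_h$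 into $\mathcal H_0$. Let $J_0$ be the (antiunitary) restriction of $J$, and $D_0$ the restriction of $D_h$ with domain $\mathcal H_0\cap\mathrm{dom}\,D_h$. Then: 1. $(\mathcal B,\mathcal H_0,D_0)$ is a spectral triple. 2. $hb=b^\circ h=J_0b^*J_0^{-1}h$ ($b\in\mathcal B$, $h\in\mathcal H_0$) defines a right action of $\mathcal B$ on $\mathcal H_0$, that is, a unital $*$-representation of the opposite algebra $\mathcal B^\circ$. 3. $[b,J_0c^*J_0^{-1}]=0$ for all $b,c\in\mathcal B$; that is, $J_0$ maps $\mathcal B$ into its commutant. 4. $[[D_0,b],J_0c^*J_0^{-1}]=0$ for all $b,c\in\mathcal B$ (first order condition). 5. $\gamma$ anticommutes with $D_0$: $\gamma$ preserves $\mathrm{dom}\,D_0$ and $\gamma D_0=-D_0\gamma$. -/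

import Mathlib

/-! ### Unbounded operators on a Hilbert space -/

namespace TorusTriple

section Unbounded

variable {H : Type*} [NormedAddCommGroup H] [InnerProductSpace ℂ H]

/-- `S T ⊆ c T S` for an unbounded operator `T`, an everywhere defined map `S` and a sign
`c = 1` or `c = -1`: `S` maps the domain of `T` into itself, and `T (S ψ) = c S (T ψ)` there.
For `c = 1` this is `[S, T] = 0`, for `c = -1` it is `S T + T S = 0`. -/
def CommutesUpTo (T : H →ₗ.[ℂ] H) (S : H → H) (c : ℤ) : Prop :=
  ∀ ψ (hψ : ψ ∈ T.domain), ∃ h : S ψ ∈ T.domain, T ⟨S ψ, h⟩ = c • S (T ⟨ψ, hψ⟩)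

/-- Strong commutation `[δ, T] = 0` of an unbounded selfadjoint operator `δ` with an unbounded
operator `T`: every non-real resolvent of `δ` commutes with `T`, that is
`(δ - z)⁻¹ T ⊆ T (δ - z)⁻¹`. -/
def StronglyCommutes (δ T : H →ₗ.[ℂ] H) : Prop :=
  ∀ z : ℂ, z.im ≠ 0 → ∀ φ (hφ : φ ∈ δ.domain) (hT : δ ⟨φ, hφ⟩ - z • φ ∈ T.domain),
    ∃ (hφT : φ ∈ T.domain) (hTφ : T ⟨φ, hφT⟩ ∈ δ.domain),
      δ ⟨T ⟨φ, hφT⟩, hTφ⟩ - z • T ⟨φ, hφT⟩ = T ⟨δ ⟨φ, hφ⟩ - z • φ, hT⟩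

/-- The bounded operator `C` is the commutator `[T, S]`: the bounded operator `S` preserves the
domain of `T`, and `T S - S T = C` on that domain. (For densely defined `T` there is at most one
such `C`.) -/
def IsCommutator (T : H →ₗ.[ℂ] H) (S C : H →L[ℂ] H) : Prop :=
  ∀ ψ (hψ : ψ ∈ T.domain), ∃ h : S ψ ∈ T.domain, T ⟨S ψ, h⟩ - S (T ⟨ψ, hψ⟩) = C ψ

/-- `(T - i)⁻¹` exists as an everywhere defined compact operator. -/
def HasCompactResolvent (T : H →ₗ.[ℂ] H) : Prop :=
  ∃ R : H →L[ℂ] H, IsCompactOperator R ∧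
    (∀ ψ, ∃ h : R ψ ∈ T.domain, T ⟨R ψ, h⟩ - Complex.I • R ψ = ψ) ∧
    (∀ ψ (hψ : ψ ∈ T.domain), R (T ⟨ψ, hψ⟩ - Complex.I • ψ) = ψ)

/-- A bounded operator as an unbounded operator with domain the whole space. -/
def ofBounded (S : H →L[ℂ] H) : H →ₗ.[ℂ] H :=
  (S : H →ₗ[ℂ] H).toPMap ⊤

/-- The composition `S T` on the domain of `T`. -/
def leftMul (S : H →L[ℂ] H) (T : H →ₗ.[ℂ] H) : H →ₗ.[ℂ] H :=
  (S : H →ₗ[ℂ] H).compPMap T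

/-- The composition `T S` on `{ψ | S ψ ∈ dom T}`. -/
def rightMul (T : H →ₗ.[ℂ] H) (S : H →L[ℂ] H) : H →ₗ.[ℂ] H where
  domain := T.domain.comap (S : H →ₗ[ℂ] H)
  toFun := T.toFun ∘ₗ ((S : H →ₗ[ℂ] H).restrict fun _ hx => hx)

/-- The common kernel `{ψ | δ₁ ψ = ⋯ = δₙ ψ = 0}`. -/
def commonKernel {n : ℕ} (δ : Fin n → H →ₗ.[ℂ] H) : Submodule ℂ H :=
  ⨅ j, (LinearMap.ker (δ j).toFun).map (δ j).domain.subtype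

theorem mem_commonKernel {n : ℕ} (δ : Fin n → H →ₗ.[ℂ] H) (ψ : H) :
    ψ ∈ commonKernel δ ↔ ∀ j, ∃ h : ψ ∈ (δ j).domain, δ j ⟨ψ, h⟩ = 0 := by
  simp [commonKernel, LinearPMap.toFun_eq_coe]

/-- `T₀` is the restriction of the unbounded operator `T` to the subspace `K`: its domain is
`K ∩ dom T`, on which `T` takes values in `K`. -/
def IsRestriction (T : H →ₗ.[ℂ] H) {K : Submodule ℂ H} (T₀ : K →ₗ.[ℂ] K) : Prop :=
  (∀ ψ : K, ψ ∈ T₀.domain ↔ (ψ : H) ∈ T.domain) ∧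
    ∀ (ψ : K) (h₀ : ψ ∈ T₀.domain) (h : (ψ : H) ∈ T.domain), (T₀ ⟨ψ, h₀⟩ : H) = T ⟨ψ, h⟩

end Unbounded

/-! ### The algebra: an action of the `n`-torus as a grading by `ℤⁿ` -/

section Algebra

variable {n : ℕ} {A : Type*} [Ring A] [StarRing A] [Algebra ℂ A] [StarModule ℂ A]

/-- The grading is compatible with the involution: `(A^(k))* ⊆ A^(-k)`. -/
class StarGraded (𝒜 : (Fin n → ℤ) → Submodule ℂ A) : Prop where
  star_mem : ∀ k a, a ∈ 𝒜 k → star a ∈ 𝒜 (-k)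

/-- The derivation `δ_j` of `A`, with `δ_j a = k_j a` for `a ∈ A^(k)`. -/
noncomputable def gradingDerivation (𝒜 : (Fin n → ℤ) → Submodule ℂ A) [GradedAlgebra 𝒜]
    (j : Fin n) : A →ₗ[ℂ] A :=
  (DirectSum.toModule ℂ (Fin n → ℤ) A fun k => ((k j : ℤ) : ℂ) • (𝒜 k).subtype) ∘ₗ
    (DirectSum.decomposeLinearEquiv 𝒜).toLinearMap

theorem gradingDerivation_apply (𝒜 : (Fin n → ℤ) → Submodule ℂ A) [GradedAlgebra 𝒜]
    (j : Fin n) (k : Fin n → ℤ) (a : A) (ha : a ∈ 𝒜 k) :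
    gradingDerivation 𝒜 j a = ((k j : ℤ) : ℂ) • a := by
  have h := DirectSum.decompose_of_mem 𝒜 ha
  simp only [gradingDerivation, LinearMap.comp_apply, LinearEquiv.coe_coe,
    DirectSum.decomposeLinearEquiv_apply, h]
  erw [DirectSum.toModule_lof]
  simp

/-- The invariant subalgebra `B = A^(0)`. -/
def invariants (𝒜 : (Fin n → ℤ) → Submodule ℂ A) [GradedAlgebra 𝒜] [StarGraded 𝒜] :
    StarSubalgebra ℂ A where
  carrier := 𝒜 0
  mul_mem' ha hb := by simpa using SetLike.GradedMul.mul_mem ha hb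
  one_mem' := SetLike.GradedOne.one_mem
  add_mem' := (𝒜 0).add_mem
  zero_mem' := (𝒜 0).zero_mem
  algebraMap_mem' := SetLike.algebraMap_mem_graded 𝒜
  star_mem' ha := by simpa using StarGraded.star_mem (𝒜 := 𝒜) 0 _ ha

end Algebra

/-! ### Spectral triples -/

section Triples

variable {A : Type*} [Ring A] [StarRing A] [Algebra ℂ A] [StarModule ℂ A]
variable {H : Type*} [NormedAddCommGroup H] [InnerProductSpace ℂ H] [CompleteSpace H]

/-- The operator `J a* J⁻¹`, by which `a` acts from the right: `ψ ⬝ a = J a* J⁻¹ ψ`. -/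
noncomputable def rightAction (π : A →⋆ₐ[ℂ] (H →L[ℂ] H)) (J : H ≃ₗᵢ⋆[ℂ] H) (a : A) :
    H →L[ℂ] H :=
  (J.toContinuousLinearEquiv : H →SL[starRingEnd ℂ] H).comp
    ((π (star a)).comp (J.symm.toContinuousLinearEquiv : H →SL[starRingEnd ℂ] H))

theorem rightAction_apply (π : A →⋆ₐ[ℂ] (H →L[ℂ] H)) (J : H ≃ₗᵢ⋆[ℂ] H) (a : A) (ψ : H) :
    rightAction π J a ψ = J (π (star a) (J.symm ψ)) := rfl

/-- `(A, H, D)` is a spectral triple. (Selfadjointness of an unbounded operator includes that it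
is densely defined.) -/
structure IsSpectralTriple (π : A →⋆ₐ[ℂ] (H →L[ℂ] H)) (D : H →ₗ.[ℂ] H) : Prop where
  selfAdjoint : IsSelfAdjoint D
  bounded_commutators : ∀ a, ∃ C : H →L[ℂ] H, IsCommutator D (π a) C
  compact_resolvent : HasCompactResolvent D

/-- `J` maps the algebra into its commutant: `[a, J b* J⁻¹] = 0` for all `a`, `b`. -/
def CommutantCondition (π : A →⋆ₐ[ℂ] (H →L[ℂ] H)) (J : H ≃ₗᵢ⋆[ℂ] H) : Prop :=
  ∀ a b, Commute (π a) (rightAction π J b)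

/-- The first order condition `[[D, a], J b* J⁻¹] = 0` for all `a`, `b`. -/
def FirstOrderCondition (π : A →⋆ₐ[ℂ] (H →L[ℂ] H)) (D : H →ₗ.[ℂ] H) (J : H ≃ₗᵢ⋆[ℂ] H) : Prop :=
  ∀ a b (C : H →L[ℂ] H), IsCommutator D (π a) C → Commute C (rightAction π J b)

/-- The sign `ε` in `J² = ε` for even `KR`-dimension `d`: `+, -, -, +` for
`d = 0, 2, 4, 6` modulo `8`. -/
def signJ (d : ℕ) : ℤ := if d % 8 = 0 ∨ d % 8 = 6 then 1 else -1

/-- The sign `ε''` in `J γ = ε'' γ J` for even `KR`-dimension `d`: `+, -, +, -` for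
`d = 0, 2, 4, 6` modulo `8`. -/
def signGrading (d : ℕ) : ℤ := if d % 4 = 0 then 1 else -1

/-- `(A, H, D, J, γ)` is an even real spectral triple of `KR`-dimension `d` (modulo `8`), with the
antiunitary `J`; the sign `ε'` in `J D = ε' D J` is `+` in all even dimensions. -/
structure IsEvenRealSpectralTriple (d : ℕ) (π : A →⋆ₐ[ℂ] (H →L[ℂ] H)) (D : H →ₗ.[ℂ] H)
    (J : H ≃ₗᵢ⋆[ℂ] H) (γ : H →L[ℂ] H) : Prop extends IsSpectralTriple π D where
  even_dim : Even d
  grading_sq : γ * γ = 1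
  grading_selfAdjoint : IsSelfAdjoint γ
  grading_algebra : ∀ a, Commute γ (π a)
  grading_D : CommutesUpTo D γ (-1)
  J_sq : ∀ ψ, J (J ψ) = signJ d • ψ
  J_D : CommutesUpTo D J 1
  J_grading : ∀ ψ, J (γ ψ) = signGrading d • γ (J ψ)
  commutant : CommutantCondition π J
  first_order : FirstOrderCondition π D J

variable {n : ℕ}

/-- The equivariance of `(A, H, D, J, γ)` under the `n`-torus, implemented by the commuting
selfadjoint operators `δ_1, …, δ_n` on `H`. The operators `δ_j` have a common domain of (essential)
selfadjointness which is stable under `A`, and on which they extend the derivations of `A`. -/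
structure IsTorusEquivariant (𝒜 : (Fin n → ℤ) → Submodule ℂ A) [GradedAlgebra 𝒜]
    (π : A →⋆ₐ[ℂ] (H →L[ℂ] H)) (D : H →ₗ.[ℂ] H) (J : H ≃ₗᵢ⋆[ℂ] H) (γ : H →L[ℂ] H)
    (δ : Fin n → H →ₗ.[ℂ] H) : Prop where
  selfAdjoint : ∀ j, IsSelfAdjoint (δ j)
  commuting : ∀ i j, StronglyCommutes (δ i) (δ j)
  leibniz : ∃ 𝒟 : Submodule ℂ H, (∀ j, (δ j).HasCore 𝒟) ∧
    (∀ a, ∀ ψ ∈ 𝒟, π a ψ ∈ 𝒟) ∧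
    ∀ j a ψ, ψ ∈ 𝒟 → ∀ (h : ψ ∈ (δ j).domain) (h' : π a ψ ∈ (δ j).domain),
      δ j ⟨π a ψ, h'⟩ = π (gradingDerivation 𝒜 j a) ψ + π a (δ j ⟨ψ, h⟩)
  delta_J : ∀ j, CommutesUpTo (δ j) J (-1)
  delta_grading : ∀ j, CommutesUpTo (δ j) γ 1
  delta_D : ∀ j, StronglyCommutes (δ j) D

/-- Projectability along the fibres of an even torus-equivariant real spectral triple, by
means of the grading `Γ`. -/
structure IsProjectable (π : A →⋆ₐ[ℂ] (H →L[ℂ] H)) (J : H ≃ₗᵢ⋆[ℂ] H) (γ : H →L[ℂ] H)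
    (δ : Fin n → H →ₗ.[ℂ] H) (Γ : H →L[ℂ] H) : Prop where
  sq : Γ * Γ = 1
  selfAdjoint : IsSelfAdjoint Γ
  algebra : ∀ a, Commute Γ (π a)
  delta : ∀ j, CommutesUpTo (δ j) Γ 1
  real : ∀ ψ, J (Γ ψ) = -Γ (J ψ)
  grading : Γ * γ = (-1 : ℂ) ^ n • (γ * Γ)

/-- The horizontal Dirac operator: `½ Γ (D Γ + Γ D)` for even `n`, and `s ½ Γ (D Γ - Γ D)` for odd
`n`, with a sign `s`, on `{ψ ∈ dom D | Γ ψ ∈ dom D}`. For `s = -1` the latter is the part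
`½ (D - Γ D Γ)` of `D` that anticommutes with `Γ`, for `s = 1` it is the negative of this part. -/
noncomputable def horizontal (n : ℕ) (s : ℤˣ) (D : H →ₗ.[ℂ] H) (Γ : H →L[ℂ] H) : H →ₗ.[ℂ] H :=
  if Even n then (1 / 2 : ℂ) • leftMul Γ (rightMul D Γ + leftMul Γ D)
  else (((s : ℤ) : ℂ) * (1 / 2)) • leftMul Γ (rightMul D Γ - leftMul Γ D)

/-- Isometric fibres: `D = D_v + D_h + Z`, an equality of unbounded operators (with domains). -/
def HasIsometricFibres (π : A →⋆ₐ[ℂ] (H →L[ℂ] H)) (D : H →ₗ.[ℂ] H) (J : H ≃ₗᵢ⋆[ℂ] H)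
    (δ : Fin n → H →ₗ.[ℂ] H) (Γ : H →L[ℂ] H) (s : ℤˣ) : Prop :=
  ∃ (Dv : H →ₗ.[ℂ] H) (Z : H →L[ℂ] H),
    D = Dv + horizontal n s D Γ + ofBounded Z ∧
    (∀ ψ (h : ψ ∈ Dv.domain), ψ ∈ commonKernel δ → Dv ⟨ψ, h⟩ = 0) ∧
    CommutesUpTo Dv Γ (if Even n then -1 else 1) ∧
    (∀ j, StronglyCommutes (δ j) Dv) ∧
    (∀ a, Commute Z (π a)) ∧
    ∃ Z' : H →L[ℂ] H, IsSelfAdjoint Z' ∧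
      ∀ a ψ, rightAction π J a (Z ψ) = Z' (rightAction π J a ψ)

end Triples

end TorusTriple

namespace TorusTriple

open scoped InnerProductSpace ComplexConjugate

/-! ### Criteria for selfadjointness of unbounded operators -/

section SelfAdjoint

variable {H : Type*} [NormedAddCommGroup H] [InnerProductSpace ℂ H] [CompleteSpace H]

/-! On $H_0$ the vertical part $D_v$ vanishes, so there $D_h = D - Z$ with $Z$ bounded and commuting
with the algebra. Everything then descends from $D$.

Since every $\delta_j$ commutes strongly with $D$, the closed space $H_0$ is stable under $D$ and
its resolvents (`unbounded_apply_mem_commonKernel`, `mem_commonKernel_of_sub_smul_mem`), hence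
$D|_{H_0}$ is selfadjoint. $D_h$ is symmetric because $\Gamma$ is selfadjoint
(`symmetric_horizontal`); on $H_0$ it is therefore a symmetric bounded perturbation of $D|_{H_0}$
with the same domain, and so selfadjoint. A resolvent identity transfers compactness.

$Z$ drops out of commutators, so $[D_0,b]$ is the restriction of $[D,b]$; boundedness and the first
order condition follow. Anticommutation with $\gamma$ is algebra with
$\Gamma\gamma=(-1)^n\gamma\Gamma$. -/

theorem symmetric_of_isSelfAdjoint {T : H →ₗ.[ℂ] H} (hT : IsSelfAdjoint T) :
    T.IsFormalAdjoint T := by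
  have h := LinearPMap.adjoint_isFormalAdjoint hT.dense_domain
  rwa [LinearPMap.isSelfAdjoint_def.mp hT] at h

theorem isSelfAdjoint_of_symmetric {T : H →ₗ.[ℂ] H} (hd : Dense (T.domain : Set H))
    (hs : T.IsFormalAdjoint T)
    (hmax : ∀ y w : H, (∀ x : T.domain, ⟪w, x⟫_ℂ = ⟪y, T x⟫_ℂ) → y ∈ T.domain) :
    IsSelfAdjoint T := by
  rw [LinearPMap.isSelfAdjoint_def]
  have hle : T ≤ T.adjoint := hs.le_adjoint hd
  refine (LinearPMap.eq_of_le_of_domain_eq hle (le_antisymm hle.1 fun y hy => ?_)).symm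
  exact hmax y (T.adjoint ⟨y, hy⟩) fun x => LinearPMap.adjoint_isFormalAdjoint hd ⟨y, hy⟩ x

theorem mem_domain_of_isSelfAdjoint {T : H →ₗ.[ℂ] H} (hT : IsSelfAdjoint T) {y w : H}
    (h : ∀ x : T.domain, ⟪w, x⟫_ℂ = ⟪y, T x⟫_ℂ) : ∃ hy : y ∈ T.domain, T ⟨y, hy⟩ = w := by
  have hy : y ∈ T.domain := by
    rw [← LinearPMap.isSelfAdjoint_def.mp hT]
    exact LinearPMap.mem_adjoint_domain_of_exists y ⟨w, h⟩
  refine ⟨hy, hT.dense_domain.eq_of_inner_left ℂ fun x hx => ?_⟩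
  rw [symmetric_of_isSelfAdjoint hT ⟨y, hy⟩ ⟨x, hx⟩, ← h ⟨x, hx⟩]

omit [CompleteSpace H] in
/-- The estimate `|Im z| ‖x‖ ≤ ‖(T - z) x‖` for a symmetric operator. -/
theorem abs_im_mul_norm_le {T : H →ₗ.[ℂ] H} (hs : T.IsFormalAdjoint T) (z : ℂ) (x : T.domain) :
    |z.im| * ‖(x : H)‖ ≤ ‖T x - z • (x : H)‖ := by
  have hreal : (⟪(x : H), T x⟫_ℂ).im = 0 := by
    have h := hs x x
    rw [← inner_conj_symm] at h
    exact Complex.conj_eq_iff_im.mp h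
  have him : (⟪(x : H), T x - z • (x : H)⟫_ℂ).im = -(z.im * ‖(x : H)‖ ^ 2) := by
    rw [inner_sub_right, inner_smul_right, Complex.sub_im, hreal, inner_self_eq_norm_sq_to_K]
    simp [← Complex.ofReal_pow]
  have hle := (Complex.abs_im_le_norm _).trans (norm_inner_le_norm (𝕜 := ℂ) (x : H)
    (T x - z • (x : H)))
  rw [him, abs_neg, abs_mul, abs_of_nonneg (sq_nonneg ‖(x : H)‖)] at hle
  rcases eq_or_lt_of_le (norm_nonneg (x : H)) with h0 | h0
  · rw [← h0]; simp
  · refine le_of_mul_le_mul_left ?_ h0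
    linarith [hle]

omit [CompleteSpace H] in
theorem eq_zero_of_eigenvector {T : H →ₗ.[ℂ] H} (hs : T.IsFormalAdjoint T) {z : ℂ}
    (hz : z.im ≠ 0) {x : T.domain} (h : T x - z • (x : H) = 0) : (x : H) = 0 := by
  have := abs_im_mul_norm_le hs z x
  rw [h, norm_zero] at this
  have h2 : ‖(x : H)‖ ≤ 0 := by
    by_contra! hc
    exact absurd this (not_le.mpr (mul_pos (abs_pos.mpr hz) hc))
  exact norm_le_zero_iff.mp h2

/-- The estimate $|\mathrm{Im}\,z|\,\|x\|\le\|(T-z)x\|$ makes $(a,b)\mapsto b-za$ bounded below on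
the closed graph, so its range is closed. A vector orthogonal to the range would be an eigenvector
of $T$ for $\bar z$, hence zero. -/
theorem surjective_sub_smul {T : H →ₗ.[ℂ] H} (hT : IsSelfAdjoint T) {z : ℂ} (hz : z.im ≠ 0)
    (ψ : H) : ∃ x : T.domain, T x - z • (x : H) = ψ := by
  have hs := symmetric_of_isSelfAdjoint hT
  have hcl : IsClosed (T.graph : Set (H × H)) := hT.isClosed
  have : CompleteSpace T.graph := hcl.completeSpace_coe
  let f : T.graph →L[ℂ] H :=
    (ContinuousLinearMap.snd ℂ H H - z • ContinuousLinearMap.fst ℂ H H).comp T.graph.subtypeL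
  have hf : ∀ p : T.graph, f p = p.1.2 - z • p.1.1 := fun p => rfl
  have hz' : 0 < |z.im| := abs_pos.mpr hz
  -- The constant dominates both bounds $\|a\|\le r/|\mathrm{Im}\,z|$ and $\|b\|\le
  -- r+\|z\|\,r/|\mathrm{Im}\,z|$, where $r=\|b-za\|$.
  have hanti : AntilipschitzWith (Real.toNNReal (1 + (1 + ‖z‖) / |z.im|)) f := by
    refine AddMonoidHomClass.antilipschitz_of_bound f fun p => ?_
    obtain ⟨⟨a, b⟩, hp⟩ := p
    obtain ⟨x, hx, hb⟩ := (LinearPMap.mem_graph_iff T).mp hp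
    simp only at hx hb
    rw [Real.coe_toNNReal _ (by positivity), hf]
    have h1 := abs_im_mul_norm_le hs z x
    rw [hx, hb] at h1
    have h2 : ‖a‖ ≤ ‖b - z • a‖ / |z.im| := by rw [le_div_iff₀ hz']; linarith
    have h3 : ‖b‖ ≤ ‖b - z • a‖ + ‖z‖ * ‖a‖ := by
      calc ‖b‖ = ‖(b - z • a) + z • a‖ := by simp
        _ ≤ _ := (norm_add_le _ _).trans (by rw [norm_smul])
    have h4 : ‖z‖ * ‖a‖ ≤ ‖z‖ * (‖b - z • a‖ / |z.im|) := by gcongr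
    have h5 : 0 ≤ ‖b - z • a‖ / |z.im| := by positivity
    have h6 : (1 + (1 + ‖z‖) / |z.im|) * ‖b - z • a‖ =
        ‖b - z • a‖ + ‖b - z • a‖ / |z.im| + ‖z‖ * (‖b - z • a‖ / |z.im|) := by ring
    have h7 : ‖(⟨(a, b), hp⟩ : T.graph)‖ = max ‖a‖ ‖b‖ := rfl
    have h8 : 0 ≤ ‖z‖ * (‖b - z • a‖ / |z.im|) := by positivity
    rw [h7, h6]
    refine max_le ?_ ?_
    · linarith [norm_nonneg (b - z • a)]
    · linarith
  have hrange : IsClosed (Set.range f) := hanti.isClosed_range f.uniformContinuous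
  have : CompleteSpace (LinearMap.range (f : T.graph →ₗ[ℂ] H)) :=
    IsClosed.completeSpace_coe (s := Set.range f) (hs := hrange)
  have htop : LinearMap.range (f : T.graph →ₗ[ℂ] H) = ⊤ := by
    rw [← Submodule.orthogonal_eq_bot_iff, Submodule.eq_bot_iff]
    intro y hy
    have hy' : ∀ x : T.domain, ⟪(conj z) • y, x⟫_ℂ = ⟪y, T x⟫_ℂ := by
      intro x
      have h := (Submodule.mem_orthogonal' _ y).mp hy (f ⟨((x : H), T x), T.mem_graph x⟩) ⟨_, rfl⟩
      rw [hf, inner_sub_right, inner_smul_right, sub_eq_zero] at h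
      rw [inner_smul_left, Complex.conj_conj, h]
    obtain ⟨hyT, hTy⟩ := mem_domain_of_isSelfAdjoint hT hy'
    exact eq_zero_of_eigenvector hs (z := conj z) (x := ⟨y, hyT⟩) (by simpa using hz)
      (by rw [hTy, sub_self])
  obtain ⟨p, hp⟩ : ψ ∈ LinearMap.range (f : T.graph →ₗ[ℂ] H) := htop ▸ Submodule.mem_top
  obtain ⟨x, hx, hb⟩ := (LinearPMap.mem_graph_iff T).mp p.2
  refine ⟨x, ?_⟩
  rw [hx, hb]
  exact hp

theorem exists_resolvent {T : H →ₗ.[ℂ] H} (hT : IsSelfAdjoint T) {z : ℂ} (hz : z.im ≠ 0) :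
    ∃ R : H →L[ℂ] H, (∀ ψ, ∃ h : R ψ ∈ T.domain, T ⟨R ψ, h⟩ - z • R ψ = ψ) ∧
      ∀ ψ (hψ : ψ ∈ T.domain), R (T ⟨ψ, hψ⟩ - z • ψ) = ψ := by
  have hs := symmetric_of_isSelfAdjoint hT
  let g : T.domain →ₗ[ℂ] H := T.toFun - z • T.domain.subtype
  have hg : ∀ x, g x = T x - z • (x : H) := fun x => rfl
  have hbij : Function.Bijective g := by
    refine ⟨?_, surjective_sub_smul hT hz⟩
    rw [injective_iff_map_eq_zero]
    intro x hx
    exact Subtype.ext (eq_zero_of_eigenvector hs hz hx)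
  let e := LinearEquiv.ofBijective g hbij
  have he : ∀ x, e x = T x - z • (x : H) := fun x => rfl
  refine ⟨(T.domain.subtype ∘ₗ e.symm.toLinearMap).mkContinuous |z.im|⁻¹ fun ψ => ?_,
    fun ψ => ⟨(e.symm ψ).2, ?_⟩, fun ψ hψ => ?_⟩
  · have h := abs_im_mul_norm_le hs z (e.symm ψ)
    rw [← he, e.apply_symm_apply] at h
    rw [inv_mul_eq_div, le_div_iff₀ (abs_pos.mpr hz), mul_comm]
    exact h
  · exact (he _).symm.trans (e.apply_symm_apply ψ)
  · have h := e.symm_apply_apply ⟨ψ, hψ⟩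
    rw [he] at h
    exact congrArg Subtype.val h

/-- A symmetric operator `T` with surjective `T - z` and `T - z̄` is selfadjoint. -/
theorem isSelfAdjoint_of_surjective {T : H →ₗ.[ℂ] H} (hs : T.IsFormalAdjoint T) {z : ℂ}
    (h₁ : ∀ ψ : H, ∃ x : T.domain, T x - z • (x : H) = ψ)
    (h₂ : ∀ ψ : H, ∃ x : T.domain, T x - conj z • (x : H) = ψ) : IsSelfAdjoint T := by
  refine isSelfAdjoint_of_symmetric ?_ hs fun y w h => ?_
  · rw [Submodule.dense_iff_topologicalClosure_eq_top, Submodule.topologicalClosure_eq_top_iff,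
      Submodule.eq_bot_iff]
    intro y hy
    obtain ⟨x, hx⟩ := h₁ y
    -- For $y=(T-z)x$ orthogonal to the domain and $(T-\bar z)u=x$: $0=\langle y,u\rangle=\langle
    -- x,(T-\bar z)u\rangle=\|x\|^2$.
    have hx0 : (x : H) = 0 := by
      have hy' : ∀ v : T.domain, ⟪y, v⟫_ℂ = 0 := fun v =>
        (Submodule.mem_orthogonal' _ y).mp hy v v.2
      obtain ⟨u, hu⟩ := h₂ (x : H)
      have h0 := hy' u
      rw [← hx, inner_sub_left, inner_smul_left, hs x u, ← inner_smul_right, ← inner_sub_right,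
        hu] at h0
      exact inner_self_eq_zero.mp h0
    have hx1 : x = 0 := Subtype.ext hx0
    rw [← hx, hx1]
    simp
  -- If $y$ lies in the adjoint domain with image $w$, this $x$ is the only candidate for $y$;
  -- indeed $y-x$ is orthogonal to the range of $T-\bar z$.
  · obtain ⟨x, hx⟩ := h₁ (w - z • y)
    have hw : w - T x = z • (y - x) := by
      rw [smul_sub, sub_eq_sub_iff_add_eq_add]
      rw [sub_eq_sub_iff_add_eq_add] at hx
      rw [← hx]; abel
    obtain ⟨v, hv⟩ := h₂ (y - x)
    have h0 : ⟪y - x, T v - conj z • (v : H)⟫_ℂ = 0 := by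
      rw [inner_sub_right, inner_smul_right, inner_sub_left, ← h v, ← hs x v, ← inner_sub_left, hw,
        inner_smul_left, sub_self]
    rw [hv] at h0
    have := sub_eq_zero.mp (inner_self_eq_zero.mp h0)
    rw [this]
    exact x.2

/-- $S$ need not be selfadjoint: symmetry of $T'$ is assumed separately, and $S$ only has to move
across the inner product, replacing $w$ by $w+S^*y$. -/
theorem isSelfAdjoint_of_bounded_perturbation {T T' : H →ₗ.[ℂ] H} (hT : IsSelfAdjoint T)
    (hs : T'.IsFormalAdjoint T') (S : H →L[ℂ] H) (hdom : T'.domain = T.domain)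
    (h : ∀ x (hx : x ∈ T.domain) (hx' : x ∈ T'.domain), T' ⟨x, hx'⟩ = T ⟨x, hx⟩ - S x) :
    IsSelfAdjoint T' := by
  refine isSelfAdjoint_of_symmetric (by rw [hdom]; exact hT.dense_domain) hs fun y w hyw => ?_
  rw [hdom]
  refine (mem_domain_of_isSelfAdjoint hT (w := w + S.adjoint y) fun x => ?_).1
  have hx' : (x : H) ∈ T'.domain := by rw [hdom]; exact x.2
  rw [inner_add_left, hyw ⟨x, hx'⟩, h x x.2 hx', inner_sub_right,
    ContinuousLinearMap.adjoint_inner_left]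
  simp

end SelfAdjoint

/-! ### Restriction of operators to invariant subspaces -/

section Restriction

variable {H : Type*} [NormedAddCommGroup H] [InnerProductSpace ℂ H]

/-- The restriction of a bounded operator to an invariant subspace. -/
def restrictBounded (S : H →L[ℂ] H) (K : Submodule ℂ H) (h : ∀ ψ ∈ K, S ψ ∈ K) : K →L[ℂ] K :=
  (S.comp K.subtypeL).codRestrict K fun ψ => h ψ ψ.2

@[simp]
theorem coe_restrictBounded_apply (S : H →L[ℂ] H) (K : Submodule ℂ H) (h : ∀ ψ ∈ K, S ψ ∈ K)
    (ψ : K) : (restrictBounded S K h ψ : H) = S ψ := rfl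

/-- The restriction of an unbounded operator to an invariant subspace. -/
def restrictUnbounded (T : H →ₗ.[ℂ] H) (K : Submodule ℂ H)
    (h : ∀ ψ ∈ K, ∀ hψ : ψ ∈ T.domain, T ⟨ψ, hψ⟩ ∈ K) : K →ₗ.[ℂ] K where
  domain := T.domain.comap K.subtype
  toFun :=
    { toFun := fun ψ => ⟨T ⟨ψ.1, ψ.2⟩, h _ ψ.1.2 ψ.2⟩
      map_add' := fun ψ φ => Subtype.ext (T.map_add ⟨ψ.1, ψ.2⟩ ⟨φ.1, φ.2⟩)
      map_smul' := fun c ψ => Subtype.ext (T.map_smul c ⟨ψ.1, ψ.2⟩) }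

theorem mem_restrictUnbounded_domain {T : H →ₗ.[ℂ] H} {K : Submodule ℂ H}
    {h : ∀ ψ ∈ K, ∀ hψ : ψ ∈ T.domain, T ⟨ψ, hψ⟩ ∈ K} (ψ : K) :
    ψ ∈ (restrictUnbounded T K h).domain ↔ (ψ : H) ∈ T.domain := Iff.rfl

theorem coe_restrictUnbounded_apply {T : H →ₗ.[ℂ] H} {K : Submodule ℂ H}
    {h : ∀ ψ ∈ K, ∀ hψ : ψ ∈ T.domain, T ⟨ψ, hψ⟩ ∈ K} (ψ : (restrictUnbounded T K h).domain) :
    (restrictUnbounded T K h ψ : H) = T ⟨ψ.1, ψ.2⟩ := rfl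

theorem isRestriction_restrictUnbounded (T : H →ₗ.[ℂ] H) (K : Submodule ℂ H)
    (h : ∀ ψ ∈ K, ∀ hψ : ψ ∈ T.domain, T ⟨ψ, hψ⟩ ∈ K) :
    IsRestriction T (restrictUnbounded T K h) :=
  ⟨fun _ => Iff.rfl, fun _ _ _ => rfl⟩

theorem symmetric_restrictUnbounded {T : H →ₗ.[ℂ] H} (hs : T.IsFormalAdjoint T)
    (K : Submodule ℂ H) (h : ∀ ψ ∈ K, ∀ hψ : ψ ∈ T.domain, T ⟨ψ, hψ⟩ ∈ K) :
    (restrictUnbounded T K h).IsFormalAdjoint (restrictUnbounded T K h) :=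
  fun x y => hs ⟨x.1, x.2⟩ ⟨y.1, y.2⟩

/-- The restriction of an antiunitary operator to a subspace preserved by it and its inverse. -/
def restrictAntiunitary (J : H ≃ₗᵢ⋆[ℂ] H) (K : Submodule ℂ H) (h : ∀ ψ ∈ K, J ψ ∈ K)
    (h' : ∀ ψ ∈ K, J.symm ψ ∈ K) : K ≃ₗᵢ⋆[ℂ] K where
  toFun ψ := ⟨J ψ, h ψ ψ.2⟩
  invFun ψ := ⟨J.symm ψ, h' ψ ψ.2⟩
  map_add' ψ φ := Subtype.ext (map_add J (ψ : H) φ)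
  map_smul' c ψ := Subtype.ext (J.map_smulₛₗ c (ψ : H))
  left_inv ψ := Subtype.ext (J.symm_apply_apply ψ)
  right_inv ψ := Subtype.ext (J.apply_symm_apply ψ)
  norm_map' ψ := J.norm_map ψ

variable [CompleteSpace H] {K : Submodule ℂ H}

/-- The restriction of a selfadjoint operator to a closed subspace invariant under the operator
and its resolvents is selfadjoint. -/
theorem isSelfAdjoint_restrictUnbounded [CompleteSpace K] {T : H →ₗ.[ℂ] H} (hT : IsSelfAdjoint T)
    (h : ∀ ψ ∈ K, ∀ hψ : ψ ∈ T.domain, T ⟨ψ, hψ⟩ ∈ K)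
    (hres : ∀ z : ℂ, z.im ≠ 0 → ∀ φ (hφ : φ ∈ T.domain), T ⟨φ, hφ⟩ - z • φ ∈ K → φ ∈ K) :
    IsSelfAdjoint (restrictUnbounded T K h) := by
  have hsurj : ∀ z : ℂ, z.im ≠ 0 → ∀ ψ : K,
      ∃ x : (restrictUnbounded T K h).domain, restrictUnbounded T K h x - z • (x : K) = ψ := by
    intro z hz ψ
    obtain ⟨x, hx⟩ := surjective_sub_smul hT hz (ψ : H)
    have hxK : (x : H) ∈ K := hres z hz x x.2 (by rw [Subtype.coe_eta, hx]; exact ψ.2)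
    exact ⟨⟨⟨x, hxK⟩, x.2⟩, Subtype.ext hx⟩
  exact isSelfAdjoint_of_surjective
    (symmetric_restrictUnbounded (symmetric_of_isSelfAdjoint hT) K h)
    (hsurj Complex.I (by simp)) (hsurj (conj Complex.I) (by simp))

omit [CompleteSpace H] in
/-- If `T₀` on `K` differs from the restriction of `T` by a bounded operator, then `T₀` inherits
compactness of the resolvent. -/
theorem hasCompactResolvent_of_perturbation [CompleteSpace K] {T : H →ₗ.[ℂ] H}
    (hT : HasCompactResolvent T) {T₀ : K →ₗ.[ℂ] K} (hT₀ : IsSelfAdjoint T₀) (Z : H →L[ℂ] H)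
    (hdiff : ∀ (ψ : K) (h₀ : ψ ∈ T₀.domain), ∃ h : (ψ : H) ∈ T.domain,
      (T₀ ⟨ψ, h₀⟩ : H) = T ⟨ψ, h⟩ - Z ψ) :
    HasCompactResolvent T₀ := by
  obtain ⟨R, hR, -, hR₂⟩ := hT
  obtain ⟨R₀, hR₀, hR₀'⟩ := exists_resolvent hT₀ (z := Complex.I) (by simp)
  refine ⟨R₀, ?_, hR₀, hR₀'⟩
  -- Since $(T-i)R_0\psi=\psi+ZR_0\psi$, applying $R$ gives $R_0=PR(1+ZR_0)$ on $K$, with $P$ the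
  -- projection; compactness comes from $R$.
  have hfac : R₀ = (K.orthogonalProjectionOnto.comp R).comp
      (K.subtypeL + Z.comp (K.subtypeL.comp R₀)) := by
    ext1 ψ
    obtain ⟨hd, he⟩ := hR₀ ψ
    obtain ⟨hd', he'⟩ := hdiff (R₀ ψ) hd
    have h1 := hR₂ (R₀ ψ) hd'
    have h2 : T ⟨(R₀ ψ : H), hd'⟩ - Complex.I • (R₀ ψ : H) = ψ + Z (R₀ ψ) := by
      have h3 := congrArg (Subtype.val : K → H) he
      simp only [AddSubgroupClass.coe_sub, Submodule.coe_smul, he'] at h3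
      rw [← h3]; abel
    rw [h2] at h1
    simp only [ContinuousLinearMap.comp_apply, add_apply,
      Submodule.subtypeL_apply]
    rw [h1, Submodule.orthogonalProjectionOnto_mem_subspace_eq_self]
  rw [hfac]
  exact (hR.clm_comp K.orthogonalProjectionOnto).comp_clm
    (K.subtypeL + Z.comp (K.subtypeL.comp R₀))

end Restriction

/-! ### The common kernel of the operators $\delta_j$ -/

section CommonKernel

variable {H : Type*} [NormedAddCommGroup H] [InnerProductSpace ℂ H] {n : ℕ}

theorem mem_commonKernel_iff_graph (δ : Fin n → H →ₗ.[ℂ] H) (ψ : H) :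
    ψ ∈ commonKernel δ ↔ ∀ j, (ψ, (0 : H)) ∈ (δ j).graph := by
  simp [mem_commonKernel, LinearPMap.mem_graph_iff]

theorem isClosed_commonKernel {δ : Fin n → H →ₗ.[ℂ] H} (h : ∀ j, (δ j).IsClosed) :
    IsClosed (commonKernel δ : Set H) := by
  have : (commonKernel δ : Set H) =
      ⋂ j, (fun ψ : H => (ψ, (0 : H))) ⁻¹' ((δ j).graph : Set (H × H)) := by
    ext ψ
    simp [mem_commonKernel_iff_graph]
  rw [this]
  exact isClosed_iInter fun j => (h j).preimage (by fun_prop)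

theorem apply_mem_commonKernel {δ : Fin n → H →ₗ.[ℂ] H} {S : H → H} {c : ℤ} (hS : S 0 = 0)
    (h : ∀ j, CommutesUpTo (δ j) S c) : ∀ ψ ∈ commonKernel δ, S ψ ∈ commonKernel δ := by
  intro ψ hψ
  rw [mem_commonKernel] at hψ ⊢
  intro j
  obtain ⟨hd, h0⟩ := hψ j
  obtain ⟨hd', h'⟩ := h j ψ hd
  exact ⟨hd', by rw [h', h0, hS, smul_zero]⟩

/-- On the kernel $(\delta_j-i)\psi=-i\psi$, so commutation with the resolvent yields
$(\delta_j-i)T\psi=-iT\psi$. -/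
theorem unbounded_apply_mem_commonKernel {δ : Fin n → H →ₗ.[ℂ] H} {T : H →ₗ.[ℂ] H}
    (h : ∀ j, StronglyCommutes (δ j) T) :
    ∀ ψ ∈ commonKernel δ, ∀ hψ : ψ ∈ T.domain, T ⟨ψ, hψ⟩ ∈ commonKernel δ := by
  intro ψ hψ hT
  rw [mem_commonKernel] at hψ ⊢
  intro j
  obtain ⟨hd, h0⟩ := hψ j
  have hmem : δ j ⟨ψ, hd⟩ - Complex.I • ψ ∈ T.domain := by
    rw [h0, zero_sub]
    exact T.domain.neg_mem (T.domain.smul_mem _ hT)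
  obtain ⟨hT', hδ, he⟩ := h j Complex.I (by simp) ψ hd hmem
  refine ⟨hδ, ?_⟩
  have h2 : (⟨δ j ⟨ψ, hd⟩ - Complex.I • ψ, hmem⟩ : T.domain) = -(Complex.I • ⟨ψ, hT⟩) :=
    Subtype.ext (by simp [h0])
  rw [h2, T.map_neg, T.map_smul, sub_eq_iff_eq_add, neg_add_cancel] at he
  exact he

/-- With $\chi=(\delta_j-i)^{-1}\varphi$, both $(T-z)\chi$ and $i(T-z)\varphi$ are sent to
$(T-z)\varphi$ by $\delta_j-i$. Injectivity of $\delta_j-i$ and then of $T-z$ gives $\chi=i\varphi$,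
which says $\delta_j\varphi=0$. -/
theorem mem_commonKernel_of_sub_smul_mem [CompleteSpace H] {δ : Fin n → H →ₗ.[ℂ] H}
    {T : H →ₗ.[ℂ] H} (hδ : ∀ j, IsSelfAdjoint (δ j)) (hT : IsSelfAdjoint T)
    (h : ∀ j, StronglyCommutes (δ j) T) (z : ℂ) (hz : z.im ≠ 0) (φ : H) (hφ : φ ∈ T.domain)
    (hψ : T ⟨φ, hφ⟩ - z • φ ∈ commonKernel δ) : φ ∈ commonKernel δ := by
  rw [mem_commonKernel] at hψ ⊢
  intro j
  obtain ⟨hd, h0⟩ := hψ j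
  obtain ⟨χ, hχ⟩ := surjective_sub_smul (hδ j) (z := Complex.I) (by simp) φ
  obtain ⟨hχT, hTχ, he⟩ := h j Complex.I (by simp) χ χ.2
    (by rw [Subtype.coe_eta, hχ]; exact hφ)
  simp only [Subtype.coe_eta, hχ] at he
  let u : (δ j).domain := ⟨T ⟨χ, hχT⟩, hTχ⟩ - z • χ
  have hu : δ j u - Complex.I • (u : H) = T ⟨φ, hφ⟩ - z • φ := by
    have : δ j u = δ j ⟨T ⟨χ, hχT⟩, hTχ⟩ - z • δ j χ := by
      rw [LinearPMap.map_sub, LinearPMap.map_smul]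
    rw [this, ← he, ← hχ]
    simp only [u, AddSubgroupClass.coe_sub, Submodule.coe_smul, smul_sub, smul_comm z Complex.I]
    abel
  let v : (δ j).domain := Complex.I • ⟨T ⟨φ, hφ⟩ - z • φ, hd⟩
  have hv : δ j v - Complex.I • (v : H) = T ⟨φ, hφ⟩ - z • φ := by
    simp only [v, LinearPMap.map_smul, h0, Submodule.coe_smul, smul_smul, Complex.I_mul_I]
    simp
  have huv : (u : H) = v := by
    have := eq_zero_of_eigenvector (symmetric_of_isSelfAdjoint (hδ j)) (z := Complex.I) (by simp)
      (x := u - v) (by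
        rw [LinearPMap.map_sub, AddSubgroupClass.coe_sub, smul_sub, sub_sub_sub_comm, hu,
          hv, sub_self])
    rwa [AddSubgroupClass.coe_sub, sub_eq_zero] at this
  have hχφ : (χ : H) = Complex.I • φ := by
    have := eq_zero_of_eigenvector (symmetric_of_isSelfAdjoint hT) hz
      (x := ⟨χ, hχT⟩ - Complex.I • ⟨φ, hφ⟩) (by
        rw [LinearPMap.map_sub, LinearPMap.map_smul]
        have h3 : T ⟨χ, hχT⟩ - z • (χ : H) = Complex.I • (T ⟨φ, hφ⟩ - z • φ) := huv
        simp only [AddSubgroupClass.coe_sub, Submodule.coe_smul, smul_sub] at h3 ⊢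
        rw [sub_sub_sub_comm, h3, smul_comm z Complex.I, sub_self])
    simpa [sub_eq_zero] using this
  have hφχ : φ = -(Complex.I • (χ : H)) := by rw [hχφ, smul_smul]; simp
  have hφd : φ ∈ (δ j).domain := by
    rw [hφχ]
    exact (δ j).domain.neg_mem ((δ j).domain.smul_mem _ χ.2)
  refine ⟨hφd, ?_⟩
  have h4 : (⟨φ, hφd⟩ : (δ j).domain) = -(Complex.I • χ) := Subtype.ext hφχ
  rw [h4, LinearPMap.map_neg, LinearPMap.map_smul, sub_eq_iff_eq_add.mp hχ, hχφ, smul_smul]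
  simp

end CommonKernel

/-! ### Action of the invariant subalgebra -/

section Equivariant

variable {n : ℕ} {A : Type*} [Ring A] [StarRing A] [Algebra ℂ A] [StarModule ℂ A]
variable {H : Type*} [NormedAddCommGroup H] [InnerProductSpace ℂ H] [CompleteSpace H]
variable {𝒜 : (Fin n → ℤ) → Submodule ℂ A} [GradedAlgebra 𝒜]
  {π : A →⋆ₐ[ℂ] (H →L[ℂ] H)} {D : H →ₗ.[ℂ] H} {J : H ≃ₗᵢ⋆[ℂ] H} {γ : H →L[ℂ] H}
  {δ : Fin n → H →ₗ.[ℂ] H}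

omit [CompleteSpace H] in
-- Vectors of $H_0$ need not lie in the core where the Leibniz rule holds; commutation with a
-- bounded operator extends from the core by closing the graph.
theorem mem_graph_of_core {T : H →ₗ.[ℂ] H} (hT : T.IsClosed) {𝒟 : Submodule ℂ H}
    (hc : T.HasCore 𝒟) (S : H →L[ℂ] H)
    (h : ∀ ψ ∈ 𝒟, ∀ hψ : ψ ∈ T.domain, (S ψ, S (T ⟨ψ, hψ⟩)) ∈ T.graph) {p : H × H}
    (hp : p ∈ T.graph) : (S p.1, S p.2) ∈ T.graph := by
  have hcl : (T.domRestrict 𝒟).IsClosable :=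
    hT.isClosable.leIsClosable LinearPMap.domRestrict_le
  rw [← hc.closure_eq, ← hcl.graph_closure_eq_closure_graph] at hp
  have hcont : Continuous fun q : H × H => (S q.1, S q.2) := by fun_prop
  refine closure_minimal (s := ((T.domRestrict 𝒟).graph : Set (H × H)))
    (t := (fun q : H × H => (S q.1, S q.2)) ⁻¹' (T.graph : Set (H × H))) ?_
    (IsClosed.preimage hcont hT) hp
  intro q hq
  obtain ⟨x, hx, hy⟩ := (LinearPMap.mem_graph_iff _).mp hq
  have hxd : (x : H) ∈ T.domain := x.2.2
  have hTx : T ⟨x, hxd⟩ = q.2 := by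
    rw [← hy]
    exact (LinearPMap.domRestrict_apply (x := x) (y := ⟨x, hxd⟩) rfl).symm
  have := h x x.2.1 hxd
  rw [hTx, hx] at this
  exact this

theorem IsTorusEquivariant.invariant_apply_mem (h : IsTorusEquivariant 𝒜 π D J γ δ) {b : A}
    (hb : b ∈ 𝒜 0) : ∀ ψ ∈ commonKernel δ, π b ψ ∈ commonKernel δ := by
  intro ψ hψ
  rw [mem_commonKernel_iff_graph] at hψ ⊢
  obtain ⟨𝒟, hcore, hstab, hleib⟩ := h.leibniz
  intro j
  have hz : gradingDerivation 𝒜 j b = 0 := by rw [gradingDerivation_apply 𝒜 j 0 b hb]; simp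
  have := mem_graph_of_core (h.selfAdjoint j).isClosed (hcore j) (π b) (fun φ hφ hφd => by
    have hd := (hcore j).le_domain (hstab b φ hφ)
    rw [LinearPMap.mem_graph_iff]
    exact ⟨⟨_, hd⟩, rfl, by rw [hleib j b φ hφ hφd hd, hz]; simp⟩) (hψ j)
  simpa using this

end Equivariant

/-! ### The horizontal Dirac operator -/

section Horizontal

variable {H : Type*} [NormedAddCommGroup H] [InnerProductSpace ℂ H] {n : ℕ} {s : ℤˣ}
  {D : H →ₗ.[ℂ] H} {Γ : H →L[ℂ] H}

theorem mem_horizontal_domain (ψ : H) :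
    ψ ∈ (horizontal n s D Γ).domain ↔ Γ ψ ∈ D.domain ∧ ψ ∈ D.domain := by
  unfold horizontal
  split_ifs <;> rfl

/-- Since $\Gamma^2=1$, both parities take the common form $c\,(\Gamma D\Gamma+(-1)^nD)$ with a real
scalar $c$. -/
theorem horizontal_apply (hΓ : Γ * Γ = 1) (ψ : H) (h : ψ ∈ (horizontal n s D Γ).domain)
    (h₁ : Γ ψ ∈ D.domain) (h₂ : ψ ∈ D.domain) :
    horizontal n s D Γ ⟨ψ, h⟩ = (if Even n then (1 / 2 : ℂ) else ((s : ℤ) : ℂ) * (1 / 2)) •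
      (Γ (D ⟨Γ ψ, h₁⟩) + (-1 : ℂ) ^ n • D ⟨ψ, h₂⟩) := by
  have hΓΓ : ∀ x, Γ (Γ x) = x := fun x => by
    rw [← mul_apply_eq_comp, hΓ, one_apply_eq_self]
  revert h
  by_cases hn : Even n
  · rw [horizontal, if_pos hn, if_pos hn, hn.neg_one_pow, one_smul]
    intro h
    change (1 / 2 : ℂ) • Γ (D ⟨Γ ψ, h₁⟩ + Γ (D ⟨ψ, h₂⟩)) = _
    rw [map_add, hΓΓ]
  · rw [horizontal, if_neg hn, if_neg hn, (Nat.not_even_iff_odd.mp hn).neg_one_pow]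
    intro h
    change (((s : ℤ) : ℂ) * (1 / 2)) • Γ (D ⟨Γ ψ, h₁⟩ - Γ (D ⟨ψ, h₂⟩)) = _
    rw [map_sub, hΓΓ, neg_one_smul, sub_eq_add_neg]

end Horizontal

/-! ### Consequences of isometric fibres -/

section IsometricFibres

variable {A : Type*} [Ring A] [StarRing A] [Algebra ℂ A] [StarModule ℂ A]
variable {H : Type*} [NormedAddCommGroup H] [InnerProductSpace ℂ H] [CompleteSpace H] {n : ℕ}
  {s : ℤˣ} {D : H →ₗ.[ℂ] H} {Γ γ : H →L[ℂ] H} {π : A →⋆ₐ[ℂ] (H →L[ℂ] H)} {J : H ≃ₗᵢ⋆[ℂ] H}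
  {δ : Fin n → H →ₗ.[ℂ] H}

omit [StarModule ℂ A] in
-- The domain of the sum $D_v+D_h+Z$ lies in $\mathrm{dom}\,D_h$, so equality of domains forces
-- $\Gamma$ to preserve $\mathrm{dom}\,D$.
theorem HasIsometricFibres.apply_mem_domain (h : HasIsometricFibres π D J δ Γ s) (ψ : H)
    (hψ : ψ ∈ D.domain) : Γ ψ ∈ D.domain := by
  obtain ⟨Dv, Z, e, -⟩ := h
  have h1 : ψ ∈ (Dv + horizontal n s D Γ + ofBounded Z).domain := by rwa [← e]
  exact ((mem_horizontal_domain ψ).mp h1.1.2).1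

omit [StarModule ℂ A] in
theorem HasIsometricFibres.horizontal_domain (h : HasIsometricFibres π D J δ Γ s) :
    (horizontal n s D Γ).domain = D.domain := by
  ext ψ
  rw [mem_horizontal_domain]
  exact ⟨fun hψ => hψ.2, fun hψ => ⟨h.apply_mem_domain ψ hψ, hψ⟩⟩

omit [StarModule ℂ A] in
theorem HasIsometricFibres.exists_difference (h : HasIsometricFibres π D J δ Γ s) :
    ∃ Z : H →L[ℂ] H, (∀ a, Commute Z (π a)) ∧ ∀ ψ ∈ commonKernel δ, ∀ (h₁ : ψ ∈ D.domain)
      (h₂ : ψ ∈ (horizontal n s D Γ).domain),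
      horizontal n s D Γ ⟨ψ, h₂⟩ = D ⟨ψ, h₁⟩ - Z ψ := by
  obtain ⟨Dv, Z, e, hv, -, -, hZ, -⟩ := h
  refine ⟨Z, hZ, fun ψ hψ h₁ h₂ => ?_⟩
  have h3 : ψ ∈ (Dv + horizontal n s D Γ + ofBounded Z).domain := by rwa [← e]
  have h4 := (LinearPMap.dExt_iff.mp e).2 (x := ⟨ψ, h₁⟩) (y := ⟨ψ, h3⟩) rfl
  have h5 : (Dv + horizontal n s D Γ + ofBounded Z) ⟨ψ, h3⟩ =
      Dv ⟨ψ, h3.1.1⟩ + horizontal n s D Γ ⟨ψ, h₂⟩ + Z ψ := rfl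
  rw [h4, h5, hv ψ h3.1.1 hψ, zero_add, add_sub_cancel_right]

theorem symmetric_horizontal (hD : IsSelfAdjoint D) (hΓ : Γ * Γ = 1) (hΓ' : IsSelfAdjoint Γ) :
    (horizontal n s D Γ).IsFormalAdjoint (horizontal n s D Γ) := by
  rintro ⟨x, hx⟩ ⟨y, hy⟩
  obtain ⟨hx1, hx2⟩ := (mem_horizontal_domain x).mp hx
  obtain ⟨hy1, hy2⟩ := (mem_horizontal_domain y).mp hy
  have hs := symmetric_of_isSelfAdjoint hD
  have hΓs : ∀ u v, ⟪Γ u, v⟫_ℂ = ⟪u, Γ v⟫_ℂ := fun u v => by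
    rw [← ContinuousLinearMap.adjoint_inner_right, ContinuousLinearMap.isSelfAdjoint_iff'.mp hΓ']
  have hc : conj (if Even n then (1 / 2 : ℂ) else ((s : ℤ) : ℂ) * (1 / 2)) =
      if Even n then (1 / 2 : ℂ) else ((s : ℤ) : ℂ) * (1 / 2) := by
    split_ifs <;> simp [Complex.conj_ofNat]
  rw [horizontal_apply hΓ x hx hx1 hx2, horizontal_apply hΓ y hy hy1 hy2, inner_smul_left,
    inner_smul_right, hc, inner_add_left, inner_add_right, inner_smul_left, inner_smul_right,
    hΓs, hs ⟨Γ x, hx1⟩ ⟨Γ y, hy1⟩, hs ⟨x, hx2⟩ ⟨y, hy2⟩, hΓs]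
  simp

omit [CompleteSpace H] in
theorem horizontal_apply_mem (hΓ : Γ * Γ = 1) {K : Submodule ℂ H}
    (hΓK : ∀ ψ ∈ K, Γ ψ ∈ K) (hDK : ∀ ψ ∈ K, ∀ hψ : ψ ∈ D.domain, D ⟨ψ, hψ⟩ ∈ K) :
    ∀ ψ ∈ K, ∀ hψ : ψ ∈ (horizontal n s D Γ).domain, horizontal n s D Γ ⟨ψ, hψ⟩ ∈ K := by
  intro ψ hψ hd
  obtain ⟨h1, h2⟩ := (mem_horizontal_domain ψ).mp hd
  rw [horizontal_apply hΓ ψ hd h1 h2]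
  exact K.smul_mem _ (K.add_mem (hΓK _ (hDK _ (hΓK ψ hψ) h1)) (K.smul_mem _ (hDK _ hψ h2)))

omit [CompleteSpace H] in
-- Moving $\gamma$ through $\Gamma D\Gamma$ produces $(-1)^n$ twice; these cancel, leaving the sign
-- from $D$.
theorem horizontal_anticommutes (hΓ : Γ * Γ = 1) (hγΓ : Γ * γ = (-1 : ℂ) ^ n • (γ * Γ))
    (hγ : CommutesUpTo D γ (-1)) : CommutesUpTo (horizontal n s D Γ) γ (-1) := by
  intro ψ hψ
  obtain ⟨h1, h2⟩ := (mem_horizontal_domain ψ).mp hψ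
  obtain ⟨k1, e1⟩ := hγ (Γ ψ) h1
  obtain ⟨k2, e2⟩ := hγ ψ h2
  have hΓγ : ∀ x, Γ (γ x) = (-1 : ℂ) ^ n • γ (Γ x) := fun x => congrArg (fun S => S x) hγΓ
  have h3 : Γ (γ ψ) ∈ D.domain := by
    rw [hΓγ]
    exact D.domain.smul_mem _ k1
  have hd := (mem_horizontal_domain (n := n) (s := s) (γ ψ)).mpr ⟨h3, k2⟩
  refine ⟨hd, ?_⟩
  have e3 : D ⟨Γ (γ ψ), h3⟩ = (-1 : ℂ) ^ n • D ⟨γ (Γ ψ), k1⟩ := by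
    rw [← D.map_smul]
    exact congrArg D (Subtype.ext (hΓγ ψ))
  have hsq : (-1 : ℂ) ^ n * (-1 : ℂ) ^ n = 1 := by rw [← mul_pow]; simp
  rw [horizontal_apply hΓ _ hd h3 k2, horizontal_apply hΓ ψ hψ h1 h2, e3, e1, e2]
  simp only [neg_smul, one_smul, smul_neg, map_neg, map_smul, map_add, hΓγ, smul_smul, hsq]
  module

end IsometricFibres

/-! ### The right action and the restricted commutators -/

section RightAction

variable {A : Type*} [Ring A] [StarRing A] [Algebra ℂ A] [StarModule ℂ A]
variable {H : Type*} [NormedAddCommGroup H] [InnerProductSpace ℂ H]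

/-- By polarization: an antilinear isometry preserves the real terms and exchanges those with $i$
and $-i$. -/
theorem inner_antiunitary (J : H ≃ₗᵢ⋆[ℂ] H) (x y : H) : ⟪J x, J y⟫_ℂ = ⟪y, x⟫_ℂ := by
  have h1 : ‖J x + J y‖ = ‖x + y‖ := by rw [← map_add, J.norm_map]
  have h2 : ‖J x - J y‖ = ‖x - y‖ := by rw [← map_sub, J.norm_map]
  have h3 : ‖J x - Complex.I • J y‖ = ‖x + Complex.I • y‖ := by
    rw [← J.norm_map (x + _), map_add, J.map_smulₛₗ]
    simp [sub_eq_add_neg]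
  have h4 : ‖J x + Complex.I • J y‖ = ‖x - Complex.I • y‖ := by
    rw [← J.norm_map (x - _), map_sub, J.map_smulₛₗ]
    simp
  rw [← inner_conj_symm y x, inner_eq_sum_norm_sq_div_four, inner_eq_sum_norm_sq_div_four x y]
  simp only [RCLike.I_to_complex, h1, h2, h3, h4]
  simp [Complex.conj_ofNat]
  ring

variable [CompleteSpace H]

/-- The right action `a ↦ J a* J⁻¹` as a representation of the opposite algebra. -/
noncomputable def rightRepresentation (π : A →⋆ₐ[ℂ] (H →L[ℂ] H)) (J : H ≃ₗᵢ⋆[ℂ] H) :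
    Aᵐᵒᵖ →⋆ₐ[ℂ] (H →L[ℂ] H) where
  toFun a := rightAction π J a.unop
  map_one' := by ext ψ; simp [rightAction_apply]
  map_mul' a b := by ext ψ; simp [rightAction_apply]
  map_zero' := by ext ψ; simp [rightAction_apply]
  map_add' a b := by ext ψ; simp [rightAction_apply]
  commutes' c := by
    ext ψ
    simp [rightAction_apply, Algebra.algebraMap_eq_smul_one, J.map_smulₛₗ]
  map_star' a := by
    rw [ContinuousLinearMap.star_eq_adjoint, ContinuousLinearMap.eq_adjoint_iff]
    intro x y
    obtain ⟨x, rfl⟩ := J.surjective x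
    obtain ⟨y, rfl⟩ := J.surjective y
    rw [rightAction_apply, rightAction_apply, J.symm_apply_apply, J.symm_apply_apply,
      inner_antiunitary, inner_antiunitary, MulOpposite.unop_star, map_star π (a.unop), map_star π,
      map_star π]
    exact ContinuousLinearMap.adjoint_inner_right _ _ _

/-- The restriction of a representation to a subalgebra and an invariant closed subspace. -/
noncomputable def restrictRepresentation (π : A →⋆ₐ[ℂ] (H →L[ℂ] H)) (B : StarSubalgebra ℂ A)
    (K : Submodule ℂ H) [CompleteSpace K] (h : ∀ b ∈ B, ∀ ψ ∈ K, π b ψ ∈ K) :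
    B →⋆ₐ[ℂ] (K →L[ℂ] K) where
  toFun b := restrictBounded (π b) K (h b b.2)
  map_one' := by ext ψ; simp
  map_mul' a b := by ext ψ; simp
  map_zero' := by ext ψ; simp
  map_add' a b := by ext ψ; simp
  commutes' c := by ext ψ; simp [Algebra.algebraMap_eq_smul_one]
  map_star' a := by
    rw [ContinuousLinearMap.star_eq_adjoint, ContinuousLinearMap.eq_adjoint_iff]
    intro x y
    rw [Submodule.coe_inner, Submodule.coe_inner, coe_restrictBounded_apply,
      coe_restrictBounded_apply, StarMemClass.coe_star, map_star,
      ContinuousLinearMap.star_eq_adjoint, ContinuousLinearMap.adjoint_inner_left]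

variable {π : A →⋆ₐ[ℂ] (H →L[ℂ] H)} {J : H ≃ₗᵢ⋆[ℂ] H} {B : StarSubalgebra ℂ A}
  {K : Submodule ℂ H} [CompleteSpace K] {h : ∀ b ∈ B, ∀ ψ ∈ K, π b ψ ∈ K}
  {hJ : ∀ ψ ∈ K, J ψ ∈ K} {hJ' : ∀ ψ ∈ K, J.symm ψ ∈ K}

theorem coe_rightAction_restrict (b : B) (ψ : K) :
    (rightAction (restrictRepresentation π B K h) (restrictAntiunitary J K hJ hJ') b ψ : H) =
      rightAction π J b ψ := rfl

theorem CommutantCondition.restrict (hc : CommutantCondition π J) :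
    CommutantCondition (restrictRepresentation π B K h) (restrictAntiunitary J K hJ hJ') := by
  intro a b
  ext ψ
  exact congrArg (fun S : H →L[ℂ] H => S ψ) (hc a b).eq

omit [CompleteSpace H] [CompleteSpace K] in
/-- A commutator with the restriction of `T - Z` is the restriction of the commutator with `T`,
when `Z` commutes with the representation. -/
theorem coe_commutator_perturbation {T : H →ₗ.[ℂ] H} {T₀ : K →ₗ.[ℂ] K} {S C Z : H →L[ℂ] H}
    {S₀ : K →L[ℂ] K} (hS₀ : ∀ ψ, (S₀ ψ : H) = S ψ) (hZ : Commute Z S)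
    (hdiff : ∀ (ψ : K) (h₀ : ψ ∈ T₀.domain), ∃ h : (ψ : H) ∈ T.domain,
      (T₀ ⟨ψ, h₀⟩ : H) = T ⟨ψ, h⟩ - Z ψ) (hC : IsCommutator T S C) (ψ : K) (hψ : ψ ∈ T₀.domain)
    (hSψ : S₀ ψ ∈ T₀.domain) : ((T₀ ⟨S₀ ψ, hSψ⟩ - S₀ (T₀ ⟨ψ, hψ⟩) : K) : H) = C ψ := by
  obtain ⟨h1, e1⟩ := hdiff ψ hψ
  obtain ⟨h2, e2⟩ := hdiff (S₀ ψ) hSψ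
  obtain ⟨h3, e3⟩ := hC ψ h1
  have hZ' : Z (S ψ) = S (Z ψ) := congrArg (fun S : H →L[ℂ] H => S ψ) hZ.eq
  have e4 : T ⟨(S₀ ψ : H), h2⟩ = T ⟨S ψ, h3⟩ := congrArg T (Subtype.ext (hS₀ ψ))
  rw [AddSubgroupClass.coe_sub, e2, e4, hS₀, hS₀, e1, ← e3, hZ', map_sub]
  abel

/-- The first order condition is inherited by a perturbed restriction of the operator. -/
theorem FirstOrderCondition.restrict {T : H →ₗ.[ℂ] H} (hfo : FirstOrderCondition π T J)
    {T₀ : K →ₗ.[ℂ] K} (hdense : Dense (T₀.domain : Set K))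
    (hcomm : ∀ a, ∃ C, IsCommutator T (π a) C) {Z : H →L[ℂ] H} (hZ : ∀ a, Commute Z (π a))
    (hdiff : ∀ (ψ : K) (h₀ : ψ ∈ T₀.domain), ∃ h : (ψ : H) ∈ T.domain,
      (T₀ ⟨ψ, h₀⟩ : H) = T ⟨ψ, h⟩ - Z ψ) :
    FirstOrderCondition (restrictRepresentation π B K h) T₀ (restrictAntiunitary J K hJ hJ') := by
  intro a b C₀ hC₀
  obtain ⟨C, hC⟩ := hcomm a
  -- Both sides are continuous and agree on the dense domain of $T_0$, because $Z$ cancels from the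
  -- commutator.
  have hCC : ∀ ψ : K, (C₀ ψ : H) = C ψ := by
    refine fun ψ => congrFun (Continuous.ext_on hdense (f := fun ψ : K => (C₀ ψ : H))
      (g := fun ψ : K => C ψ) (by fun_prop) (by fun_prop) fun φ hφ => ?_) ψ
    obtain ⟨h1, e1⟩ := hC₀ φ hφ
    change (C₀ φ : H) = C φ
    rw [← e1]
    exact coe_commutator_perturbation (S := π a) (fun _ => rfl) (hZ a) hdiff hC φ hφ h1
  ext ψ
  have h2 := congrArg (fun S : H →L[ℂ] H => S ψ) (hfo a b C hC).eq
  have h3 : C (rightAction π J b ψ) = rightAction π J b (C ψ) := h2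
  rw [mul_apply_eq_comp, mul_apply_eq_comp, hCC, coe_rightAction_restrict,
    coe_rightAction_restrict, hCC]
  exact h3

end RightAction

end TorusTriple

/-! ### The spectral triple on the invariant subspace -/

theorem mainTheorem2 {n : ℕ}
    {A : Type*} [Ring A] [StarRing A] [Algebra ℂ A] [StarModule ℂ A]
    (𝒜 : (Fin n → ℤ) → Submodule ℂ A) [GradedAlgebra 𝒜] [TorusTriple.StarGraded 𝒜]
    {H : Type*} [NormedAddCommGroup H] [InnerProductSpace ℂ H] [CompleteSpace H]
    (d : ℕ) (π : A →⋆ₐ[ℂ] (H →L[ℂ] H)) (D : H →ₗ.[ℂ] H) (J : H ≃ₗᵢ⋆[ℂ] H) (γ : H →L[ℂ] H)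
    (δ : Fin n → H →ₗ.[ℂ] H) (Γ : H →L[ℂ] H) (s : ℤˣ)
    (hreal : TorusTriple.IsEvenRealSpectralTriple d π D J γ)
    (hequiv : TorusTriple.IsTorusEquivariant 𝒜 π D J γ δ)
    (hproj : TorusTriple.IsProjectable π J γ δ Γ)
    (hiso : TorusTriple.HasIsometricFibres π D J δ Γ s) :
    ∃ (_ : CompleteSpace (TorusTriple.commonKernel δ))
      (π₀ : TorusTriple.invariants 𝒜 →⋆ₐ[ℂ]
        (TorusTriple.commonKernel δ →L[ℂ] TorusTriple.commonKernel δ))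
      (D₀ : TorusTriple.commonKernel δ →ₗ.[ℂ] TorusTriple.commonKernel δ)
      (J₀ : TorusTriple.commonKernel δ ≃ₗᵢ⋆[ℂ] TorusTriple.commonKernel δ)
      (γ₀ Γ₀ γΓ₀ : TorusTriple.commonKernel δ →L[ℂ] TorusTriple.commonKernel δ),
      -- the restrictions to the common kernel
      (∀ b ψ, (π₀ b ψ : H) = π (b : A) (ψ : H)) ∧
      TorusTriple.IsRestriction (TorusTriple.horizontal n s D Γ) D₀ ∧
      (∀ ψ, (J₀ ψ : H) = J (ψ : H)) ∧
      (∀ ψ, (γ₀ ψ : H) = γ (ψ : H)) ∧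
      (∀ ψ, (Γ₀ ψ : H) = Γ (ψ : H)) ∧
      (∀ ψ, (γΓ₀ ψ : H) = γ (Γ (ψ : H))) ∧
      -- their properties
      TorusTriple.IsSpectralTriple π₀ D₀ ∧
      (∃ ρ₀ : (TorusTriple.invariants 𝒜)ᵐᵒᵖ →⋆ₐ[ℂ]
          (TorusTriple.commonKernel δ →L[ℂ] TorusTriple.commonKernel δ),
        ∀ b, ρ₀ (MulOpposite.op b) = TorusTriple.rightAction π₀ J₀ b) ∧
      TorusTriple.CommutantCondition π₀ J₀ ∧
      TorusTriple.FirstOrderCondition π₀ D₀ J₀ ∧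
      TorusTriple.CommutesUpTo D₀ γ₀ (-1) := by
  open TorusTriple in
  have hD := hreal.selfAdjoint
  have hcomplete : CompleteSpace (commonKernel δ) :=
    (isClosed_commonKernel fun j => (hequiv.selfAdjoint j).isClosed).completeSpace_coe
  set K := commonKernel δ with hK
  have hJ : ∀ ψ ∈ K, J ψ ∈ K := apply_mem_commonKernel (map_zero J) hequiv.delta_J
  have hJ' : ∀ ψ ∈ K, J.symm ψ ∈ K := by
    intro ψ hψ
    -- $J^2=\epsilon=\pm1$ gives $J^{-1}=\epsilon J$.
    have h1 : J.symm ψ = signJ d • J ψ := by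
      apply J.injective
      rw [J.apply_symm_apply, map_zsmul, hreal.J_sq, smul_smul]
      unfold signJ
      split_ifs <;> simp
    rw [h1]
    exact K.toAddSubgroup.zsmul_mem (hJ ψ hψ) _
  have hγ : ∀ ψ ∈ K, γ ψ ∈ K := apply_mem_commonKernel (map_zero γ) hequiv.delta_grading
  have hΓ : ∀ ψ ∈ K, Γ ψ ∈ K := apply_mem_commonKernel (map_zero Γ) hproj.delta
  have hDK := unbounded_apply_mem_commonKernel hequiv.delta_D
  have hhK := horizontal_apply_mem (n := n) (s := s) hproj.sq hΓ hDK
  have hπ : ∀ b ∈ invariants 𝒜, ∀ ψ ∈ K, π b ψ ∈ K := fun b hb =>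
    hequiv.invariant_apply_mem hb
  have hdom := hiso.horizontal_domain
  obtain ⟨Z, hZ, hdiff⟩ := hiso.exists_difference
  have hdiff' : ∀ (ψ : K) (h₀ : ψ ∈ (restrictUnbounded (horizontal n s D Γ) K hhK).domain),
      ∃ h : (ψ : H) ∈ D.domain,
        (restrictUnbounded (horizontal n s D Γ) K hhK ⟨ψ, h₀⟩ : H) = D ⟨ψ, h⟩ - Z ψ :=
    fun ψ h₀ => ⟨hdom ▸ h₀, hdiff ψ ψ.2 _ h₀⟩
  have hsa : IsSelfAdjoint (restrictUnbounded (horizontal n s D Γ) K hhK) := by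
    refine isSelfAdjoint_of_bounded_perturbation
      (isSelfAdjoint_restrictUnbounded hD hDK
        (mem_commonKernel_of_sub_smul_mem hequiv.selfAdjoint hD hequiv.delta_D))
      (symmetric_restrictUnbounded (symmetric_horizontal hD hproj.sq hproj.selfAdjoint) K hhK)
      -- $Z$ is not assumed to preserve $K$, so it is compressed. On the domain
      -- $Z\psi=D\psi-D_h\psi$ already lies in $K$, and the projection changes nothing.
      (K.orthogonalProjectionOnto.comp (Z.comp K.subtypeL)) ?_ fun ψ hψ hψ' => ?_
    · ext ψ
      rw [mem_restrictUnbounded_domain, mem_restrictUnbounded_domain, hdom]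
    · have h1 := hdiff ψ ψ.2 hψ hψ'
      have h2 : Z ψ = ((restrictUnbounded D K hDK ⟨ψ, hψ⟩ -
          restrictUnbounded (horizontal n s D Γ) K hhK ⟨ψ, hψ'⟩ : K) : H) := by
        rw [AddSubgroupClass.coe_sub, coe_restrictUnbounded_apply, coe_restrictUnbounded_apply, h1,
          sub_sub_cancel]
      rw [ContinuousLinearMap.comp_apply, ContinuousLinearMap.comp_apply, Submodule.subtypeL_apply,
        h2, Submodule.orthogonalProjectionOnto_mem_subspace_eq_self, sub_sub_cancel]
  refine ⟨hcomplete, restrictRepresentation π (invariants 𝒜) K hπ,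
    restrictUnbounded (horizontal n s D Γ) K hhK, restrictAntiunitary J K hJ hJ',
    restrictBounded γ K hγ, restrictBounded Γ K hΓ,
    restrictBounded (γ * Γ) K fun ψ hψ => hγ _ (hΓ ψ hψ), fun _ _ => rfl,
    isRestriction_restrictUnbounded _ _ _, fun _ => rfl, fun _ => rfl, fun _ => rfl, fun _ => rfl,
    ⟨hsa, fun b => ?_, hasCompactResolvent_of_perturbation hreal.compact_resolvent hsa Z hdiff'⟩,
    ⟨rightRepresentation _ _, fun _ => rfl⟩, hreal.commutant.restrict,
    hreal.first_order.restrict hsa.dense_domain hreal.bounded_commutators hZ hdiff',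
    fun ψ hψ => ?_⟩
  · obtain ⟨C, hC⟩ := hreal.bounded_commutators b
    -- On the domain of $D_0$ the values of $C=[D,b]$ are those of $[D_0,b]$, so they lie in $K$ and
    -- the projection acts trivially.
    refine ⟨K.orthogonalProjectionOnto.comp (C.comp K.subtypeL), fun ψ hψ => ?_⟩
    have hd : restrictRepresentation π (invariants 𝒜) K hπ b ψ ∈
        (restrictUnbounded (horizontal n s D Γ) K hhK).domain := by
      rw [mem_restrictUnbounded_domain, hdom]
      exact (hC ψ (hdiff' ψ hψ).1).1
    refine ⟨hd, ?_⟩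
    rw [ContinuousLinearMap.comp_apply, ContinuousLinearMap.comp_apply, Submodule.subtypeL_apply,
      ← coe_commutator_perturbation (S := π b) (fun _ => rfl) (hZ b) hdiff' hC ψ hψ hd,
      Submodule.orthogonalProjectionOnto_mem_subspace_eq_self]
  · obtain ⟨h, e⟩ := horizontal_anticommutes (n := n) (s := s) hproj.sq hproj.grading
      hreal.grading_D ψ hψ
    exact ⟨h, Subtype.ext e⟩
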